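/- Let $0\le K\le N$ be integers. In each slot $t=0,1,2,\dots$ a scheduler serves exactly $K$ of $N$ clients. Client $i$ has parameters $R_i>0$, $\theta_i\in\mathbb R$, $p_i\in(0,1]$; its state $s_i(t)\in\{0,1,2,\dots\}$ is the time since its last delivery. If client $i$ is served in slot $t$, its packet is delivered with probability $p_i$, independently of the past and of the other clients; then $s_i(t+1)=0$ if a packet is delivered and $s_i(t+1)=s_i(t)+1$ otherwise. A policy may be randomized and may depend on the whole past. Its average reward (an element of $[-\infty,\infty]$) is $$\liminf_{T\to\infty}\frac1T\,\mathbb E\sum_{t=0}^{T}\sum_{i=1}^N R_i\bigl(\theta_i\mathbf 1\{s_i(t)=0\}-s_i(t)\bigr).$$ For one client $i$ in isolation and a subsidy $W\in\mathbb R$, in each slot one chooses to be active (serve the client) or passive, and earns $R_i(\theta_i\mathbf 1\{s=0\}-s)$, plus $W$ if passive. Let $C^{\mathrm{Avg},i}(W)$ be the supremum, over all policies started in state $0$, of the average reward (the $\liminf$ defined as above). The threshold-$n$ policy is passive if $s<n$ and active if $s\ge n$. Let $\Pi_i(W)$ be the set of states in which some optimal threshold policy is passive, and $W_i(m)=\inf\{w\in\mathbb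 R: m\in\Pi_i(w)\}$ the Whittle index of state $m$. Call $n_i\in\{0,1,2,\dots\}$ a threshold determined by $W$ if $W\le W_i(n_i)$ and either $n_i=0$ or $W_i(n_i-1)\le W$. Then: (1) For every initial state and every scheduling policy, the average reward is at most $$\inf_{W>0}\Bigl[\sum_{i=1}^N C^{\mathrm{Avg},i}(W)-W(N-K)\Bigr].$$ (2) For all $i$ and $m\ge0$, $W_i(m)=(m+1)R_ip_i\Bigl(\dfrac{m+1}{2}+\dfrac{1-p_i}{p_i}+\dfrac12\Bigr)+R_ip_i\theta_i$. (3) For each $i$ and $W>0$ a threshold determined by $W$ exists, and for every such $n_i$ the threshold-$n_i$ policy attains $C^{\mathrm{Avg},i}(W)$, with $$C^{\mathrm{Avg},i}(W)=W\frac{n_ip_i}{n_ip_i+1}-\frac{R_ip_i(n_i^2+n_i)}{2(n_ip_i+1)}+\frac{R_ip_i\theta_i}{n_ip_i+1}-\frac{R_i(1-p_i)}{p_i}.$$ (4) For any choice of thresholds $n_i=n_i(W)$ determined by $W$, the bound in (1) equals $$\inf_{W>0}\Bigl[\sum_{i=1}^N\Bigl(W\frac{n_ip_i}{n_ip_i+1}-\frac{R_ip_i(n_i^2+n_i)}{2(n_ip_i+1)}+\frac{R_ip_i\theta_i}{n_ip_i+1}-\frac{R_i(1-p_i)}{p_i}\Bigr)-W(N-K)\Bigr]$$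 $$=\inf_{W>0}\Bigl[W\Bigl(\sum_{i=1}^N\frac{n_ip_i}{n_ip_i+1}+K-N\Bigr)+\sum_{i=1}^N\Bigl(-\frac{R_ip_i(n_i^2+n_i)}{2(n_ip_i+1)}+\frac{R_ip_i\theta_i}{n_ip_i+1}-\frac{R_i(1-p_i)}{p_i}\Bigr)\Bigr].$$ -/

import Mathlib

open scoped BigOperators

noncomputable section

/-- A controlled Markov process with state space `S` and action set `A`: a transition law and a
one-slot reward depending on the current state and action. -/
structure CtrlProcess (S A : Type) where
  trans : S → A → PMF S
  reward : S → A → ℝ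

namespace CtrlProcess

variable {S A : Type}

/-- A history-dependent, possibly randomized, policy: given the list of past (state, action) pairs
(most recent first; its length is the current time) and the current state, it gives the law of the
next action. -/
abbrev Policy (_ : CtrlProcess S A) : Type := List (S × A) → S → PMF A

/-- Joint law of (past state-action pairs, current state) at time `t`, started from `s₀`. -/
def historyLaw (M : CtrlProcess S A) (π : M.Policy) (s₀ : S) : ℕ → PMF (List (S × A) × S)
  | 0 => PMF.pure ([], s₀)
  | t + 1 => (historyLaw M π s₀ t).bind fun x =>
      (π x.1 x.2).bind fun a => (M.trans x.2 a).map fun s' => ((x.2, a) :: x.1, s')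

/-- Law of the state-action pair at time `t`. -/
def pairLaw (M : CtrlProcess S A) (π : M.Policy) (s₀ : S) (t : ℕ) : PMF (S × A) :=
  (M.historyLaw π s₀ t).bind fun x => (π x.1 x.2).map fun a => (x.2, a)

/-- Expected reward in slot `t`. In the processes used below the law at time `t` has finite support,
so this sum is finite. -/
def expReward (M : CtrlProcess S A) (π : M.Policy) (s₀ : S) (t : ℕ) : ℝ :=
  ∑' x : S × A, (M.pairLaw π s₀ t x).toReal * M.reward x.1 x.2

/-- `liminf_{T → ∞} (1/T) E ∑_{t=0}^{T} reward(t)`, as an extended real (it may be `-∞`). -/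
def avgReward (M : CtrlProcess S A) (π : M.Policy) (s₀ : S) : EReal :=
  Filter.liminf
    (fun T : ℕ => (((1 / (T : ℝ)) * ∑ t ∈ Finset.range (T + 1), M.expReward π s₀ t : ℝ) : EReal))
    Filter.atTop

end CtrlProcess

/-- Parameters of a client: weight `R > 0`, trade-off parameter `θ`, channel reliability `p`. -/
structure Client where
  R : ℝ
  θ : ℝ
  p : ℝ
  R_pos : 0 < R
  p_pos : 0 < p
  p_le_one : p ≤ 1

namespace Client

/-- Channel of one client in one slot: `true` (a transmission succeeds) with probability `p`. -/
def channel (c : Client) : PMF Bool :=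
  PMF.ofFintype (fun b => if b then ENNReal.ofReal c.p else ENNReal.ofReal (1 - c.p)) (by
    have h := c.p_le_one
    simp only [Fintype.sum_bool, if_true, Bool.false_eq_true, if_false]
    rw [← ENNReal.ofReal_add c.p_pos.le (by linarith)]
    simp)

/-- Next value of the time since last delivery, given whether the client was served and whether its
channel was good. -/
def nextState (s : ℕ) (served good : Bool) : ℕ :=
  if served && good then 0 else s + 1

/-- One-slot reward `R (θ 1(s = 0) - s)`. -/
def slotReward (c : Client) (s : ℕ) : ℝ :=
  c.R * (c.θ * (if s = 0 then 1 else 0) - (s : ℝ))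

/-- The single-client problem with subsidy `w` for passivity; action `true` is active. -/
def single (c : Client) (w : ℝ) : CtrlProcess ℕ Bool where
  trans s a := c.channel.map (nextState s a)
  reward s a := c.slotReward s + (if a then 0 else w)

/-- The threshold policy: passive when `s < T`, active when `s ≥ T`. -/
def thresholdPolicy (c : Client) (w : ℝ) (T : ℕ) : (c.single w).Policy :=
  fun _ s => PMF.pure (decide (T ≤ s))

/-- The maximal single-client average reward under subsidy `w`, over all policies
(starting just after a delivery). -/
def optAvg (c : Client) (w : ℝ) : EReal :=
  ⨆ π : (c.single w).Policy, (c.single w).avgReward π 0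

/-- The threshold policy with threshold `T` maximizes the single-client average reward. -/
def ThresholdOptimal (c : Client) (w : ℝ) (T : ℕ) : Prop :=
  (c.single w).avgReward (c.thresholdPolicy w T) 0 = c.optAvg w

/-- The passive set `Π(w)`: the states in which some optimal threshold policy is passive. -/
def passiveSet (c : Client) (w : ℝ) : Set ℕ :=
  {n | ∃ T, c.ThresholdOptimal w T ∧ n < T}

/-- The Whittle index `inf {w : n ∈ Π(w)}` of state `n` for the average reward problem. -/
def whittleIndex (c : Client) (n : ℕ) : ℝ :=
  sInf {w : ℝ | n ∈ c.passiveSet w}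

/-- `n` is a threshold determined by the subsidy `w`: the states `0, …, n - 1` have index at most
`w`, and state `n` has index at least `w`. -/
def IsThresholdFor (c : Client) (w : ℝ) (n : ℕ) : Prop :=
  (n = 0 ∨ c.whittleIndex (n - 1) ≤ w) ∧ w ≤ c.whittleIndex n

end Client

/-- The channels of the `N` clients in one slot are independent. -/
def jointChannel {N : ℕ} (c : Fin N → Client) : PMF (Fin N → Bool) :=
  PMF.ofFintype (fun ξ => ∏ i, (c i).channel (ξ i)) (by
    rw [← Fintype.piFinset_univ, ← Finset.prod_univ_sum]
    refine Finset.prod_eq_one fun i _ => ?_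
    rw [← tsum_fintype (L := .unconditional _)]
    exact (c i).channel.tsum_coe)

/-- The scheduling problem: in every slot exactly `K` of the `N` clients are served. -/
def scheduling {N : ℕ} (c : Fin N → Client) (K : ℕ) :
    CtrlProcess (Fin N → ℕ) {u : Finset (Fin N) // u.card = K} where
  trans s u := (jointChannel c).map fun ξ i => Client.nextState (s i) (decide (i ∈ u.1)) (ξ i)
  reward s _ := ∑ i, (c i).slotReward (s i)

end

/-! The argument is verification through the average-reward optimality inequality. A function `H` on
states and a number `g` with reward plus expected next `H` at most `g + H`, for every action,
telescope to a bound on the partial sums by `g` per slot, up to the expected terminal value of `-H`.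
For one client, `H` is `relValue` and `g` is `thresholdReward`. The latter is a renewal average: a
cycle is `T` passive slots followed by a geometric number of active ones, of mean `1 / p`. Equality
holds along the threshold policy; the inequality holds for both actions exactly because the subsidy
lies between consecutive values of `switchSubsidy` (`relValue_optimality`). As these values increase
strictly, they are the Whittle indices. For the scheduler, the sum of the `relValue`s is again a
solution: exactly `N - K` clients are passive in each slot, so the subsidies add up to a constant
(`avgReward_scheduling_le`). No projection of a joint policy to one client is needed. Since `H` is
unbounded below, the terminal term need not be negligible. It is dominated by a multiple of minus
the next reward, and `liminf_average_le` shows that this suffices. -/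

noncomputable section

/-- Expectation of a real function under a discrete law (meaningful for finitely supported laws). -/
def expect {α : Type} (p : PMF α) (f : α → ℝ) : ℝ := ∑' x, (p x).toReal * f x

/-! ### Expectations under finitely supported laws -/

section Expect

variable {α β : Type}

lemma summable_expect {p : PMF α} (hp : p.support.Finite) (f : α → ℝ) :
    Summable fun x => (p x).toReal * f x := by
  refine summable_of_hasFiniteSupport (hp.subset fun x hx => ?_)
  rw [PMF.mem_support_iff]
  intro h
  simp [h] at hx

lemma expect_eq_sum [Fintype α] (p : PMF α) (f : α → ℝ) :
    expect p f = ∑ x, (p x).toReal * f x := tsum_fintype _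

lemma sum_toReal_eq_one (p : PMF α) : ∑' x, (p x).toReal = 1 := by
  rw [← ENNReal.tsum_toReal_eq fun x => p.apply_ne_top x, p.tsum_coe, ENNReal.toReal_one]

lemma expect_const (p : PMF α) (a : ℝ) : expect p (fun _ => a) = a := by
  rw [expect, tsum_mul_right, sum_toReal_eq_one, one_mul]

lemma expect_pure (a : α) (f : α → ℝ) : expect (PMF.pure a) f = f a := by
  classical
  rw [expect, tsum_eq_single a]
  · simp
  · intro b hb
    simp [PMF.pure_apply, hb]

lemma expect_add {p : PMF α} (hp : p.support.Finite) (f g : α → ℝ) :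
    expect p (fun x => f x + g x) = expect p f + expect p g := by
  simp only [expect, mul_add]
  exact (summable_expect hp f).tsum_add (summable_expect hp g)

lemma expect_const_mul (p : PMF α) (a : ℝ) (f : α → ℝ) :
    expect p (fun x => a * f x) = a * expect p f := by
  simp only [expect, mul_left_comm _ a, tsum_mul_left]

lemma expect_mono {p : PMF α} (hp : p.support.Finite) {f g : α → ℝ}
    (h : ∀ x ∈ p.support, f x ≤ g x) : expect p f ≤ expect p g := by
  refine (summable_expect hp f).tsum_le_tsum (fun x => ?_) (summable_expect hp g)
  by_cases hx : x ∈ p.support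
  · exact mul_le_mul_of_nonneg_left (h x hx) ENNReal.toReal_nonneg
  · rw [PMF.mem_support_iff, not_not] at hx
    simp [hx]

lemma finite_support_bind {p : PMF α} {q : α → PMF β} (hp : p.support.Finite)
    (hq : ∀ x, (q x).support.Finite) : (p.bind q).support.Finite := by
  rw [PMF.support_bind]
  exact hp.biUnion fun x _ => hq x

lemma finite_support_map {p : PMF α} (f : α → β) (hp : p.support.Finite) :
    (p.map f).support.Finite := by
  rw [PMF.support_map]
  exact hp.image f

lemma expect_bind {p : PMF α} {q : α → PMF β} (hp : p.support.Finite)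
    (hq : ∀ x, (q x).support.Finite) (f : β → ℝ) :
    expect (p.bind q) f = expect p fun x => expect (q x) f := by
  have hs : Summable (Function.uncurry fun x y => (p x).toReal * ((q x y).toReal * f y)) := by
    refine summable_of_hasFiniteSupport
      ((hp.biUnion fun x _ => (Set.finite_singleton x).prod (hq x)).subset fun z hz => ?_)
    obtain ⟨x, y⟩ := z
    simp only [Function.mem_support, Function.uncurry] at hz
    simp only [Set.mem_iUnion, Set.mem_prod, Set.mem_singleton_iff, PMF.mem_support_iff]
    refine ⟨x, fun h => hz (by simp [h]), rfl, fun h => hz (by simp [h])⟩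
  calc expect (p.bind q) f
      = ∑' y, ∑' x, (p x).toReal * ((q x y).toReal * f y) := by
        refine tsum_congr fun y => ?_
        rw [PMF.bind_apply, ENNReal.tsum_toReal_eq fun x =>
          ENNReal.mul_ne_top (p.apply_ne_top x) ((q x).apply_ne_top y), ← tsum_mul_right]
        refine tsum_congr fun x => ?_
        rw [ENNReal.toReal_mul, mul_assoc]
    _ = ∑' x, ∑' y, (p x).toReal * ((q x y).toReal * f y) := hs.tsum_comm
    _ = _ := tsum_congr fun x => tsum_mul_left

lemma expect_map {p : PMF α} (hp : p.support.Finite) (g : α → β) (f : β → ℝ) :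
    expect (p.map g) f = expect p fun x => f (g x) := by
  rw [← PMF.bind_pure_comp, expect_bind hp fun x => by simp]
  simp only [Function.comp, expect_pure]

end Expect

/-! ### Long-run averages from bounds on partial sums -/

section Liminf

open Filter

/-- A reward sequence whose partial sums are at most `g` per slot up to an error controlled by the
next (negative) reward has long-run average at most `g`. -/
lemma liminf_average_le {a : ℕ → ℝ} {g C c : ℝ} (hc : 0 < c)
    (h : ∀ T : ℕ, ∑ t ∈ Finset.range (T + 1), a t ≤ (T + 1) * g + C - c * a (T + 1)) :
    liminf (fun T : ℕ => (((1 / (T : ℝ)) * ∑ t ∈ Finset.range (T + 1), a t : ℝ) : EReal)) atTop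
      ≤ g := by
  by_contra hcon
  rw [not_le] at hcon
  obtain ⟨g', h1, h2⟩ := EReal.lt_iff_exists_real_btwn.1 hcon
  rw [EReal.coe_lt_coe_iff] at h1
  obtain ⟨T₀, hT₀⟩ := eventually_atTop.1 (eventually_lt_of_lt_liminf h2)
  -- If the liminf exceeded `g' > g`, the partial sums would eventually stay above `g' * T`.
  have hS : ∀ T : ℕ, T₀ ≤ T → 1 ≤ T → g' * T ≤ ∑ t ∈ Finset.range (T + 1), a t := by
    intro T hT hT1
    have hT' : (0 : ℝ) < T := by exact_mod_cast hT1
    have := hT₀ T hT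
    rw [EReal.coe_lt_coe_iff, one_div, inv_mul_eq_div, lt_div_iff₀ hT'] at this
    exact this.le
  -- Combining `h` with `hS` gives `c * a (T + 1) ≤ g + C - T * (g' - g)`; past `T₁` this is below
  -- `c * (g - 1)`.
  obtain ⟨T₁, hT₁⟩ := exists_nat_gt ((g + C - c * (g - 1)) / (g' - g))
  have hgap : 0 < g' - g := by linarith
  have hdrop : ∀ T : ℕ, T₀ ≤ T → 1 ≤ T → T₁ ≤ T → a (T + 1) ≤ g - 1 := by
    intro T h3 h4 h5
    have h6 : (T₁ : ℝ) ≤ T := by exact_mod_cast h5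
    rw [div_lt_iff₀ hgap] at hT₁
    have h7 := mul_le_mul_of_nonneg_right h6 hgap.le
    have h8 := hS T h3 h4
    have h9 := h T
    have : c * a (T + 1) ≤ c * (g - 1) := by linarith
    exact le_of_mul_le_mul_left this hc
  set T₂ := max T₀ (max 1 T₁) with hT₂
  have hle : T₀ ≤ T₂ ∧ 1 ≤ T₂ ∧ T₁ ≤ T₂ := by simp [hT₂]
  -- Rewards that are all at most `g - 1` force the partial sums to grow too slowly for `hS`.
  have hsum : ∀ k : ℕ, ∑ t ∈ Finset.range (T₂ + k + 1), a t
      ≤ ∑ t ∈ Finset.range (T₂ + 1), a t + k * (g - 1) := by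
    intro k
    induction k with
    | zero => simp
    | succ k ih =>
      have := hdrop (T₂ + k) (by omega) (by omega) (by omega)
      rw [show T₂ + (k + 1) + 1 = (T₂ + k + 1) + 1 by ring, Finset.sum_range_succ]
      push_cast
      linarith
  obtain ⟨k, hk⟩ := exists_nat_gt (∑ t ∈ Finset.range (T₂ + 1), a t - g' * T₂)
  have h3 := hsum k
  have h4 := hS (T₂ + k) (by omega) (by omega)
  push_cast at h4
  have h5 : (0 : ℝ) ≤ k * (g' - g) := by positivity
  linarith

lemma le_liminf_average {a : ℕ → ℝ} {g C : ℝ}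
    (h : ∀ T : ℕ, (T + 1) * g + C ≤ ∑ t ∈ Finset.range (T + 1), a t) :
    (g : EReal) ≤
      liminf (fun T : ℕ => (((1 / (T : ℝ)) * ∑ t ∈ Finset.range (T + 1), a t : ℝ) : EReal))
        atTop := by
  have hlim : Tendsto (fun T : ℕ => g + (g + C) * (1 / (T : ℝ))) atTop (nhds g) := by
    simpa using (tendsto_one_div_atTop_nhds_zero_nat (𝕜 := ℝ)).const_mul (g + C) |>.const_add g
  rw [← (EReal.tendsto_coe.2 hlim).liminf_eq]
  refine liminf_le_liminf ?_
  filter_upwards [eventually_ge_atTop 1] with T hT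
  have hT' : (0 : ℝ) < T := by exact_mod_cast hT
  rw [EReal.coe_le_coe_iff]
  calc g + (g + C) * (1 / (T : ℝ)) = 1 / (T : ℝ) * ((T + 1) * g + C) := by field_simp; ring
    _ ≤ _ := mul_le_mul_of_nonneg_left (h T) (by positivity)

end Liminf

/-! ### Verification theorems for controlled processes -/

namespace CtrlProcess

variable {S A : Type} [Finite A] {M : CtrlProcess S A}

lemma finite_support_historyLaw (hM : ∀ s a, (M.trans s a).support.Finite) (π : M.Policy)
    (s₀ : S) (t : ℕ) : (M.historyLaw π s₀ t).support.Finite := by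
  induction t with
  | zero => simp [historyLaw]
  | succ t ih =>
    exact finite_support_bind ih fun x => finite_support_bind (Set.toFinite _) fun a =>
      finite_support_map _ (hM _ _)

lemma expReward_eq (hM : ∀ s a, (M.trans s a).support.Finite) (π : M.Policy) (s₀ : S) (t : ℕ) :
    M.expReward π s₀ t =
      expect (M.historyLaw π s₀ t) fun x => expect (π x.1 x.2) fun a => M.reward x.2 a := by
  change expect (M.pairLaw π s₀ t) (fun x => M.reward x.1 x.2) = _
  rw [pairLaw, expect_bind (finite_support_historyLaw hM π s₀ t)
    fun x => finite_support_map _ (Set.toFinite _)]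
  simp only [expect_map (Set.toFinite (PMF.support _))]

lemma expect_historyLaw_succ (hM : ∀ s a, (M.trans s a).support.Finite) (π : M.Policy) (s₀ : S)
    (t : ℕ) (H : S → ℝ) :
    expect (M.historyLaw π s₀ (t + 1)) (fun x => H x.2) =
      expect (M.historyLaw π s₀ t) fun x => expect (π x.1 x.2) fun a =>
        expect (M.trans x.2 a) H := by
  rw [historyLaw, expect_bind (finite_support_historyLaw hM π s₀ t)
    fun x => finite_support_bind (Set.toFinite _) fun a => finite_support_map _ (hM _ _)]
  congr 1
  funext x
  rw [expect_bind (Set.toFinite _) fun a => finite_support_map _ (hM _ _)]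
  simp only [expect_map (hM _ _)]

lemma expReward_add_expect_historyLaw_succ (hM : ∀ s a, (M.trans s a).support.Finite)
    (π : M.Policy) (s₀ : S) (t : ℕ) (H : S → ℝ) :
    M.expReward π s₀ t + expect (M.historyLaw π s₀ (t + 1)) (fun x => H x.2) =
      expect (M.historyLaw π s₀ t) fun x => expect (π x.1 x.2) fun a =>
        M.reward x.2 a + expect (M.trans x.2 a) H := by
  rw [expReward_eq hM, expect_historyLaw_succ hM,
    ← expect_add (finite_support_historyLaw hM π s₀ t)]
  congr 1
  funext x
  rw [← expect_add (Set.toFinite _)]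

lemma expect_historyLaw_const_add (hM : ∀ s a, (M.trans s a).support.Finite)
    (π : M.Policy) (s₀ : S) (t : ℕ) (H : S → ℝ) (g : ℝ) :
    (expect (M.historyLaw π s₀ t) fun x => expect (π x.1 x.2) fun _ => g + H x.2) =
      g + expect (M.historyLaw π s₀ t) fun x => H x.2 := by
  simp only [expect_const]
  rw [expect_add (finite_support_historyLaw hM π s₀ t), expect_const]

/-- Verification, upper bound: a solution `H` of the average reward optimality inequality whose
negative part is controlled by the reward bounds the average reward. -/
theorem avgReward_le (hM : ∀ s a, (M.trans s a).support.Finite) (π : M.Policy) (s₀ : S)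
    (H : S → ℝ) {g C c : ℝ} (hc : 0 < c)
    (hH : ∀ l s, ∀ a ∈ (π l s).support, M.reward s a + expect (M.trans s a) H ≤ g + H s)
    (hC : ∀ s a, -H s ≤ C - c * M.reward s a) : M.avgReward π s₀ ≤ g := by
  have hfin := finite_support_historyLaw hM π s₀
  have hstep : ∀ t, M.expReward π s₀ t + expect (M.historyLaw π s₀ (t + 1)) (fun x => H x.2)
      ≤ g + expect (M.historyLaw π s₀ t) fun x => H x.2 := by
    intro t
    rw [expReward_add_expect_historyLaw_succ hM, ← expect_historyLaw_const_add hM]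
    exact expect_mono (hfin t) fun x _ => expect_mono (Set.toFinite _) fun a ha => hH _ _ a ha
  -- The terminal value left by telescoping is charged to the reward of the same slot, the form that
  -- `liminf_average_le` accepts.
  have hlow : ∀ t, -expect (M.historyLaw π s₀ t) (fun x => H x.2)
      ≤ C - c * M.expReward π s₀ t := by
    intro t
    have h0 : (expect (M.historyLaw π s₀ t) fun x => expect (π x.1 x.2) fun a =>
        c * M.reward x.2 a) ≤
        expect (M.historyLaw π s₀ t) fun x => expect (π x.1 x.2) fun _ => C + H x.2 :=
      expect_mono (hfin t) fun x _ => expect_mono (Set.toFinite _) fun a _ => by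
        linarith [hC x.2 a]
    rw [expect_historyLaw_const_add hM] at h0
    simp only [expect_const_mul] at h0
    rw [← expReward_eq hM] at h0
    linarith
  refine liminf_average_le (C := H s₀ + C) hc fun T => ?_
  have hsum : ∀ T : ℕ, ∑ t ∈ Finset.range T, M.expReward π s₀ t
      + expect (M.historyLaw π s₀ T) (fun x => H x.2) ≤ T * g + H s₀ := by
    intro T
    induction T with
    | zero => simp [historyLaw, expect_pure]
    | succ T ih =>
      rw [Finset.sum_range_succ]
      push_cast
      linarith [hstep T]
  have := hsum (T + 1)
  push_cast at this
  linarith [hlow (T + 1)]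

/-- Verification, lower bound. -/
theorem le_avgReward (hM : ∀ s a, (M.trans s a).support.Finite) (π : M.Policy) (s₀ : S)
    (H : S → ℝ) {g C : ℝ}
    (hH : ∀ l s, ∀ a ∈ (π l s).support, g + H s ≤ M.reward s a + expect (M.trans s a) H)
    (hC : ∀ s, H s ≤ C) : (g : EReal) ≤ M.avgReward π s₀ := by
  have hfin := finite_support_historyLaw hM π s₀
  have hstep : ∀ t, g + expect (M.historyLaw π s₀ t) (fun x => H x.2) ≤
      M.expReward π s₀ t + expect (M.historyLaw π s₀ (t + 1)) (fun x => H x.2) := by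
    intro t
    rw [expReward_add_expect_historyLaw_succ hM, ← expect_historyLaw_const_add hM]
    exact expect_mono (hfin t) fun x _ => expect_mono (Set.toFinite _) fun a ha => hH _ _ a ha
  refine le_liminf_average (C := H s₀ - C) fun T => ?_
  have hsum : ∀ T : ℕ, T * g + H s₀ ≤ ∑ t ∈ Finset.range T, M.expReward π s₀ t
      + expect (M.historyLaw π s₀ T) (fun x => H x.2) := by
    intro T
    induction T with
    | zero => simp [historyLaw, expect_pure]
    | succ T ih =>
      rw [Finset.sum_range_succ]
      push_cast
      linarith [hstep T]
  have h1 := hsum (T + 1)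
  have h2 : expect (M.historyLaw π s₀ (T + 1)) (fun x => H x.2) ≤ C :=
    (expect_mono (hfin _) fun x _ => hC x.2).trans_eq (expect_const _ C)
  push_cast at h1
  linarith

end CtrlProcess

/-! ### Threshold rewards and switching subsidies of one client -/

namespace Client

variable (c : Client)

lemma expect_channel (f : Bool → ℝ) :
    expect c.channel f = c.p * f true + (1 - c.p) * f false := by
  have h : 0 ≤ 1 - c.p := by linarith [c.p_le_one]
  rw [expect_eq_sum, Fintype.sum_bool]
  simp [channel, PMF.ofFintype_apply, ENNReal.toReal_ofReal, c.p_pos.le, h]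

lemma finite_support_single_trans (w : ℝ) (s : ℕ) (a : Bool) :
    ((c.single w).trans s a).support.Finite :=
  finite_support_map _ (Set.toFinite _)

lemma expect_nextState (s : ℕ) (a : Bool) (H : ℕ → ℝ) :
    expect c.channel (fun b => H (nextState s a b)) =
      if a then c.p * H 0 + (1 - c.p) * H (s + 1) else H (s + 1) := by
  rw [expect_channel]
  cases a <;> simp [nextState]
  ring

lemma expect_single_trans (w : ℝ) (s : ℕ) (a : Bool) (H : ℕ → ℝ) :
    expect ((c.single w).trans s a) H =
      if a then c.p * H 0 + (1 - c.p) * H (s + 1) else H (s + 1) := by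
  rw [← expect_nextState]
  exact expect_map (Set.toFinite _) _ _

/-- The long-run average reward of the threshold-`T` policy under subsidy `w`. -/
def thresholdReward (w : ℝ) (T : ℕ) : ℝ :=
  w * (T * c.p / (T * c.p + 1)) - c.R * c.p * ((T : ℝ) ^ 2 + T) / (2 * (T * c.p + 1))
    + c.R * c.p * c.θ / (T * c.p + 1) - c.R * (1 - c.p) / c.p

/-- The subsidy at which the thresholds `n` and `n + 1` earn the same average reward. -/
def switchSubsidy (n : ℕ) : ℝ :=
  ((n : ℝ) + 1) * c.R * c.p * (((n : ℝ) + 1) / 2 + (1 - c.p) / c.p + 1 / 2) + c.R * c.p * c.θ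

lemma switchSubsidy_eq (n : ℕ) :
    c.switchSubsidy n = c.R / 2 * (n + 1) * (n * c.p + 2) + c.R * c.p * c.θ := by
  have := c.p_pos.ne'
  rw [switchSubsidy]
  field_simp
  ring

lemma mul_p_add_one_pos (T : ℕ) : 0 < (T : ℝ) * c.p + 1 := by
  have := c.p_pos
  positivity

lemma thresholdReward_mul (w : ℝ) (T : ℕ) :
    c.thresholdReward w T * (T * c.p + 1) =
      w * T * c.p - c.R * c.p * ((T : ℝ) ^ 2 + T) / 2 + c.R * c.p * c.θ
        - c.R * (1 - c.p) / c.p * (T * c.p + 1) := by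
  have := (c.mul_p_add_one_pos T).ne'
  have := c.p_pos.ne'
  rw [thresholdReward]
  field_simp

/-- Turns the sign of `w - switchSubsidy T` into a comparison of `w - thresholdReward w T` with `R T
+ R / p`, which is what the optimality inequality needs. The companion for `T + 1` has the same
right-hand side, so both thresholds switch at one subsidy. -/
lemma sub_thresholdReward_mul (w : ℝ) (T : ℕ) :
    (w - c.thresholdReward w T - (c.R * T + c.R / c.p)) * (T * c.p + 1) =
      w - c.switchSubsidy T := by
  have h := c.thresholdReward_mul w T
  have := c.p_pos.ne'
  rw [switchSubsidy_eq, sub_mul, sub_mul, h]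
  field_simp
  ring

lemma sub_thresholdReward_succ_mul (w : ℝ) (T : ℕ) :
    (w - c.thresholdReward w (T + 1) - (c.R * T + c.R / c.p)) * ((T + 1 : ℕ) * c.p + 1) =
      w - c.switchSubsidy T := by
  have h := c.thresholdReward_mul w (T + 1)
  have := c.p_pos.ne'
  rw [switchSubsidy_eq, sub_mul, sub_mul, h]
  push_cast
  field_simp
  ring

lemma thresholdReward_le_succ_iff (w : ℝ) (T : ℕ) :
    c.thresholdReward w T ≤ c.thresholdReward w (T + 1) ↔ c.switchSubsidy T ≤ w := by
  have h1 := c.sub_thresholdReward_mul w T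
  have h2 := c.sub_thresholdReward_succ_mul w T
  have p1 := c.mul_p_add_one_pos T
  have p2 := c.mul_p_add_one_pos (T + 1)
  have hp := c.p_pos
  have key : (c.thresholdReward w (T + 1) - c.thresholdReward w T) *
      ((T * c.p + 1) * ((T + 1 : ℕ) * c.p + 1)) = (w - c.switchSubsidy T) * c.p := by
    push_cast at h2 ⊢
    linear_combination (((T : ℝ) + 1) * c.p + 1) * h1 - ((T : ℝ) * c.p + 1) * h2
  rw [← sub_nonneg, ← mul_nonneg_iff_of_pos_right (mul_pos p1 p2), key,
    mul_nonneg_iff_of_pos_right hp, sub_nonneg]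

lemma switchSubsidy_strictMono : StrictMono c.switchSubsidy := by
  refine strictMono_nat_of_lt_succ fun n => ?_
  have hR := c.R_pos
  have hp := c.p_pos
  rw [switchSubsidy_eq, switchSubsidy_eq]
  push_cast
  have : 0 < c.R / 2 * (2 * ((n : ℝ) + 1) * c.p + 2) := by positivity
  linarith

lemma exists_lt_switchSubsidy (w : ℝ) : ∃ n, w < c.switchSubsidy n := by
  have hR := c.R_pos
  obtain ⟨n, hn⟩ := exists_nat_gt ((w - c.R * c.p * c.θ) / c.R)
  refine ⟨n, ?_⟩
  rw [div_lt_iff₀ hR] at hn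
  have : 0 ≤ c.R * (1 + (n + 1) * n * c.p / 2) := by
    have := c.p_pos
    positivity
  rw [switchSubsidy_eq]
  linarith

lemma exists_threshold (w : ℝ) : ∃ n, (∀ m < n, c.switchSubsidy m ≤ w) ∧ w < c.switchSubsidy n := by
  classical
  exact ⟨Nat.find (c.exists_lt_switchSubsidy w), fun m hm => not_lt.1 (Nat.find_min _ hm),
    Nat.find_spec (c.exists_lt_switchSubsidy w)⟩

/-! ### Relative values and the optimality inequality -/

/-- Relative value of state `s` under the threshold-`T` policy, without the reward that is earned
on delivery. -/
def relValueAux (w : ℝ) (T s : ℕ) : ℝ :=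
  if s ≤ T then s * (c.thresholdReward w T - w) + c.R * (s * (s - 1)) / 2
  else c.R * c.θ - (c.thresholdReward w T + (1 - c.p) * c.R / c.p) / c.p - c.R * s / c.p

/-- Relative value of state `s` under the threshold-`T` policy. -/
def relValue (w : ℝ) (T s : ℕ) : ℝ :=
  c.relValueAux w T s + c.R * (c.θ * (if s = 0 then 1 else 0))

lemma relValueAux_of_le {w : ℝ} {T s : ℕ} (h : s ≤ T) : c.relValueAux w T s =
    s * (c.thresholdReward w T - w) + c.R * (s * (s - 1)) / 2 := if_pos h

/-- The two branches agree at `s = T`: this matching condition is the equation `thresholdReward_mul`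
for the gain. -/
lemma relValueAux_of_ge {w : ℝ} {T s : ℕ} (h : T ≤ s) : c.relValueAux w T s =
    c.R * c.θ - (c.thresholdReward w T + (1 - c.p) * c.R / c.p) / c.p - c.R * s / c.p := by
  rcases h.eq_or_lt with rfl | h
  · rw [c.relValueAux_of_le le_rfl]
    have h := c.thresholdReward_mul w T
    have hp := c.p_pos.ne'
    generalize c.thresholdReward w T = g at *
    field_simp at h ⊢
    linear_combination h
  · exact if_neg (not_le.2 h)

@[simp] lemma relValue_succ (w : ℝ) (T s : ℕ) :
    c.relValue w T (s + 1) = c.relValueAux w T (s + 1) := by simp [relValue]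

@[simp] lemma relValue_zero (w : ℝ) (T : ℕ) : c.relValue w T 0 = c.R * c.θ := by
  simp [relValue, relValueAux]

lemma relValue_sub_reward (w : ℝ) (T s : ℕ) (a : Bool) :
    c.relValue w T s - (c.single w).reward s a =
      c.relValueAux w T s + c.R * s - if a then 0 else w := by
  simp only [relValue, single, slotReward]
  ring

lemma relValue_active {w : ℝ} {T s : ℕ} (h : T ≤ s) :
    (c.single w).reward s true + expect ((c.single w).trans s true) (c.relValue w T) =
      c.thresholdReward w T + c.relValue w T s := by
  have h1 := c.relValue_sub_reward w T s true
  rw [c.relValueAux_of_ge h] at h1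
  rw [expect_single_trans, relValue_succ, relValue_zero, c.relValueAux_of_ge (by omega)]
  have hp := c.p_pos.ne'
  simp only [if_true] at h1 ⊢
  rw [sub_eq_iff_eq_add] at h1
  rw [h1]
  push_cast
  field_simp
  ring

lemma relValue_passive {w : ℝ} {T s : ℕ} (h : s < T) :
    (c.single w).reward s false + expect ((c.single w).trans s false) (c.relValue w T) =
      c.thresholdReward w T + c.relValue w T s := by
  have h1 := c.relValue_sub_reward w T s false
  rw [c.relValueAux_of_le h.le] at h1
  rw [expect_single_trans, relValue_succ, c.relValueAux_of_le (by omega)]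
  simp only [Bool.false_eq_true, if_false] at h1 ⊢
  rw [sub_eq_iff_eq_add] at h1
  rw [h1]
  push_cast
  ring

/-- The optimality inequality of the single-client problem. -/
lemma relValue_optimality {w : ℝ} {T : ℕ} (h0 : ∀ m < T, c.switchSubsidy m ≤ w)
    (h1 : w ≤ c.switchSubsidy T) (s : ℕ) (a : Bool) :
    (c.single w).reward s a + expect ((c.single w).trans s a) (c.relValue w T) ≤
      c.thresholdReward w T + c.relValue w T s := by
  have hR := c.R_pos
  have hp := c.p_pos
  have h2 := c.relValue_sub_reward w T s a
  cases a with
  | true =>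
    rcases le_or_gt T s with h | h
    · exact (c.relValue_active h).le
    · obtain ⟨n, rfl⟩ : ∃ n, T = n + 1 := ⟨T - 1, by omega⟩
      -- Being active rather than passive in `s` changes the value by `p (H 0 - H (s + 1)) - w`.
      -- This is shown to be nonpositive by replacing `s + 1` with the threshold `n + 1`, where `H`
      -- is smaller.
      have hg : c.R * n + c.R / c.p ≤ w - c.thresholdReward w (n + 1) := by
        have e := c.sub_thresholdReward_succ_mul w n
        have : 0 ≤ w - c.switchSubsidy n := sub_nonneg.2 (h0 n (by omega))
        rw [← e] at this
        linarith [nonneg_of_mul_nonneg_left this (c.mul_p_add_one_pos _)]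
      have hanti : c.relValueAux w (n + 1) (n + 1) ≤ c.relValueAux w (n + 1) (s + 1) := by
        rw [c.relValueAux_of_le le_rfl, c.relValueAux_of_le (by omega)]
        have hs : (s : ℝ) ≤ n := by exact_mod_cast (by omega : s ≤ n)
        have hd : 0 ≤ c.R / c.p := by positivity
        have k1 : c.R * n ≤ w - c.thresholdReward w (n + 1) := by linarith
        have k2 := mul_le_mul_of_nonneg_left k1 (sub_nonneg.2 hs)
        -- A product of two consecutive integers is nonnegative; over the reals it could fail, hence
        -- the split on `d`.
        have k3 : 0 ≤ c.R * ((n - s) * (n - s - 1)) := by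
          obtain ⟨d, rfl⟩ : ∃ d, n = s + d := ⟨n - s, by omega⟩
          refine mul_nonneg hR.le ?_
          rcases d with _ | d
          · simp
          · push_cast
            ring_nf
            positivity
        push_cast
        nlinarith
      have hlast : c.p * (c.R * c.θ - c.relValueAux w (n + 1) (n + 1)) ≤ w := by
        rw [c.relValueAux_of_ge le_rfl]
        have : c.p * (c.R * c.θ - (c.R * c.θ - (c.thresholdReward w (n + 1)
          + (1 - c.p) * c.R / c.p) / c.p - c.R * (n + 1 : ℕ) / c.p))
          = c.thresholdReward w (n + 1) + (c.R * n + c.R / c.p) := by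
          push_cast
          field_simp
          ring
        linarith
      have hpas := c.relValue_passive (w := w) h
      have h3 := c.relValue_sub_reward w (n + 1) s false
      rw [expect_single_trans] at hpas ⊢
      simp only [Bool.false_eq_true, if_false, if_true, relValue_succ, relValue_zero] at h2 h3 hpas ⊢
      have := mul_le_mul_of_nonneg_left hanti hp.le
      linarith
  | false =>
    rcases lt_or_ge s T with h | h
    · exact (c.relValue_passive h).le
    -- Above the threshold `H` has slope `-R / p`, so passivity is no better as soon as `w - g ≤ R s
    -- + R / p`; the case `s = T` is the tightest.
    · have hg : w - c.thresholdReward w T ≤ c.R * T + c.R / c.p := by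
        have e := c.sub_thresholdReward_mul w T
        have : 0 ≤ -(w - c.switchSubsidy T) := by linarith
        rw [← e, ← neg_mul] at this
        linarith [nonneg_of_mul_nonneg_left this (c.mul_p_add_one_pos _)]
      rw [expect_single_trans]
      rw [c.relValueAux_of_ge h] at h2
      simp only [Bool.false_eq_true, if_false, relValue_succ] at h2 ⊢
      rw [c.relValueAux_of_ge (by omega)]
      have hs : c.R * (T : ℝ) ≤ c.R * s := mul_le_mul_of_nonneg_left (by exact_mod_cast h) hR.le
      have : c.R * ((s + 1 : ℕ) : ℝ) / c.p = c.R * s / c.p + c.R / c.p := by push_cast; ring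
      linarith

lemma exists_relValue_le (w : ℝ) (T : ℕ) : ∃ C, ∀ s, c.relValue w T s ≤ C := by
  have hR := c.R_pos
  have hp := c.p_pos
  obtain ⟨B, hB⟩ := ((Finset.range (T + 1)).image (c.relValue w T)).bddAbove
  refine ⟨max B (|c.R * c.θ - (c.thresholdReward w T + (1 - c.p) * c.R / c.p) / c.p|
    + |c.R * c.θ|), fun s => ?_⟩
  rcases le_or_gt s T with h | h
  · exact le_max_of_le_left (hB (by simpa using ⟨s, by omega, rfl⟩))
  · refine le_max_of_le_right ?_
    obtain ⟨s, rfl⟩ : ∃ n, s = n + 1 := ⟨s - 1, by omega⟩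
    rw [relValue_succ, c.relValueAux_of_ge h.le]
    have : 0 ≤ c.R * ((s + 1 : ℕ) : ℝ) / c.p := by positivity
    linarith [abs_nonneg (c.R * c.θ), le_abs_self
      (c.R * c.θ - (c.thresholdReward w T + (1 - c.p) * c.R / c.p) / c.p)]

lemma exists_neg_relValue_le (w : ℝ) (T : ℕ) :
    ∃ C, ∀ s, -c.relValue w T s ≤ C + c.R * s / c.p := by
  have hR := c.R_pos
  have hp := c.p_pos
  obtain ⟨B, hB⟩ := ((Finset.range (T + 1)).image (c.relValue w T)).bddBelow
  refine ⟨max (-B) (-(c.R * c.θ - (c.thresholdReward w T + (1 - c.p) * c.R / c.p) / c.p)),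
    fun s => ?_⟩
  rcases le_or_gt s T with h | h
  · have h1 : B ≤ c.relValue w T s := hB (by simpa using ⟨s, by omega, rfl⟩)
    have : 0 ≤ c.R * (s : ℝ) / c.p := by positivity
    linarith [le_max_left (-B)
      (-(c.R * c.θ - (c.thresholdReward w T + (1 - c.p) * c.R / c.p) / c.p))]
  · obtain ⟨s, rfl⟩ : ∃ n, s = n + 1 := ⟨s - 1, by omega⟩
    rw [relValue_succ, c.relValueAux_of_ge h.le]
    linarith [le_max_right (-B)
      (-(c.R * c.θ - (c.thresholdReward w T + (1 - c.p) * c.R / c.p) / c.p))]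

/-- The negative part of the relative value is controlled by the reward in the same state. -/
lemma exists_neg_relValue_le_sub_slotReward (w : ℝ) (T : ℕ) {κ : ℝ} (hκ : 1 / c.p ≤ κ) :
    ∃ C, ∀ s, -c.relValue w T s ≤ C - κ * c.slotReward s := by
  have hR := c.R_pos
  have hp := c.p_pos
  have hκ0 : 0 < κ := lt_of_lt_of_le (by positivity) hκ
  obtain ⟨C, hC⟩ := c.exists_neg_relValue_le w T
  refine ⟨C + κ * (c.R * |c.θ|), fun s => (hC s).trans ?_⟩
  have h1 : c.R * s / c.p ≤ κ * (c.R * s) := by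
    rw [div_eq_mul_one_div, mul_comm]
    exact mul_le_mul_of_nonneg_right hκ (by positivity)
  have h2 : c.slotReward s ≤ c.R * |c.θ| - c.R * s := by
    rw [slotReward, mul_sub]
    refine sub_le_sub_right (mul_le_mul_of_nonneg_left ?_ hR.le) _
    split_ifs
    · simpa using le_abs_self c.θ
    · simp
  linarith [mul_le_mul_of_nonneg_left h2 hκ0.le]

lemma exists_neg_relValue_le_sub_reward (w : ℝ) (T : ℕ) : ∃ C, ∀ s a,
    -c.relValue w T s ≤ C - 1 / c.p * (c.single w).reward s a := by
  obtain ⟨C, hC⟩ := c.exists_neg_relValue_le_sub_slotReward w T le_rfl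
  refine ⟨C + 1 / c.p * |w|, fun s a => (hC s).trans ?_⟩
  have hp : 0 < 1 / c.p := one_div_pos.2 c.p_pos
  have : (c.single w).reward s a ≤ c.slotReward s + |w| := by
    refine add_le_add_right ?_ _
    cases a <;> simp [le_abs_self]
  linarith [mul_le_mul_of_nonneg_left this hp.le]

/-! ### Optimal thresholds and the Whittle index -/

/-- Along its own policy `relValue` satisfies the optimality relation with equality, so both
verification bounds apply, for any `w` and `T`. -/
lemma avgReward_thresholdPolicy (w : ℝ) (T : ℕ) :
    (c.single w).avgReward (c.thresholdPolicy w T) 0 = c.thresholdReward w T := by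
  have key : ∀ (l : List (ℕ × Bool)) (s : ℕ), ∀ a ∈ (c.thresholdPolicy w T l s).support,
      (c.single w).reward s a + expect ((c.single w).trans s a) (c.relValue w T) =
        c.thresholdReward w T + c.relValue w T s := by
    intro l s a ha
    rw [thresholdPolicy, PMF.support_pure, Set.mem_singleton_iff] at ha
    subst ha
    rcases le_or_gt T s with h | h
    · simpa [h] using c.relValue_active h
    · simpa [not_le.2 h] using c.relValue_passive h
  obtain ⟨C, hC⟩ := c.exists_relValue_le w T
  obtain ⟨D, hD⟩ := c.exists_neg_relValue_le_sub_reward w T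
  exact le_antisymm
    (CtrlProcess.avgReward_le (c.finite_support_single_trans w) _ _ _
      (one_div_pos.2 c.p_pos) (fun l s a ha => (key l s a ha).le) hD)
    (CtrlProcess.le_avgReward (c.finite_support_single_trans w) _ _ _
      (fun l s a ha => (key l s a ha).ge) hC)

lemma thresholdReward_le_optAvg (w : ℝ) (T : ℕ) : (c.thresholdReward w T : EReal) ≤ c.optAvg w :=
  (c.avgReward_thresholdPolicy w T).symm.trans_le
    (le_iSup (fun π => (c.single w).avgReward π 0) _)

lemma optAvg_eq {w : ℝ} {T : ℕ} (h0 : ∀ m < T, c.switchSubsidy m ≤ w)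
    (h1 : w ≤ c.switchSubsidy T) : c.optAvg w = c.thresholdReward w T := by
  refine le_antisymm (iSup_le fun π => ?_) (c.thresholdReward_le_optAvg w T)
  obtain ⟨D, hD⟩ := c.exists_neg_relValue_le_sub_reward w T
  exact CtrlProcess.avgReward_le (c.finite_support_single_trans w) _ _ _
    (one_div_pos.2 c.p_pos) (fun l s a _ => c.relValue_optimality h0 h1 s a) hD

lemma thresholdOptimal_of_switchSubsidy {w : ℝ} {T : ℕ} (h0 : ∀ m < T, c.switchSubsidy m ≤ w)
    (h1 : w ≤ c.switchSubsidy T) : c.ThresholdOptimal w T := by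
  rw [ThresholdOptimal, avgReward_thresholdPolicy, c.optAvg_eq h0 h1]

lemma mem_passiveSet_iff (w : ℝ) (n : ℕ) : n ∈ c.passiveSet w ↔ c.switchSubsidy n ≤ w := by
  constructor
  · rintro ⟨T, hT, hn⟩
    -- An optimal threshold `T > n` earns at least as much as `T - 1`, which forces `switchSubsidy
    -- (T - 1) ≤ w`; monotonicity then reaches down to `n`.
    obtain ⟨m, rfl⟩ : ∃ m, T = m + 1 := ⟨T - 1, by omega⟩
    rw [ThresholdOptimal, avgReward_thresholdPolicy] at hT
    have h := hT ▸ c.thresholdReward_le_optAvg w m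
    rw [EReal.coe_le_coe_iff, thresholdReward_le_succ_iff] at h
    exact (c.switchSubsidy_strictMono.monotone (by omega)).trans h
  · intro h
    obtain ⟨T, h0, h1⟩ := c.exists_threshold w
    exact ⟨T, c.thresholdOptimal_of_switchSubsidy h0 h1.le,
      c.switchSubsidy_strictMono.lt_iff_lt.1 (h.trans_lt h1)⟩

lemma whittleIndex_eq (n : ℕ) : c.whittleIndex n = c.switchSubsidy n := by
  simp only [whittleIndex, mem_passiveSet_iff]
  exact csInf_Ici

lemma isThresholdFor_iff (w : ℝ) (n : ℕ) : c.IsThresholdFor w n ↔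
    (∀ m < n, c.switchSubsidy m ≤ w) ∧ w ≤ c.switchSubsidy n := by
  rw [IsThresholdFor, whittleIndex_eq, whittleIndex_eq]
  refine and_congr_left fun _ => ⟨?_, fun h => ?_⟩
  · rintro (rfl | h) m hm
    · omega
    · exact (c.switchSubsidy_strictMono.monotone (by omega)).trans h
  · rcases n.eq_zero_or_pos with h0 | h0
    · exact .inl h0
    · exact .inr (h _ (by omega))

end Client

/-! ### The Lagrangian bound for the scheduler -/

section Scheduling

variable {N : ℕ} (c : Fin N → Client)

/-- Absorbing the indicator of `ξ i = b` into the `i`-th factor keeps the summand a product, so the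
sum over `ξ` factors and every other coordinate sums to one. -/
lemma map_eval_jointChannel (i : Fin N) : (jointChannel c).map (fun ξ => ξ i) = (c i).channel := by
  classical
  ext b
  have e : ∀ ξ : Fin N → Bool, (if b = ξ i then jointChannel c ξ else 0) =
      ∏ j, if j = i ∧ b ≠ ξ j then 0 else (c j).channel (ξ j) := by
    intro ξ
    by_cases h : b = ξ i
    · rw [if_pos h]
      change ∏ j, (c j).channel (ξ j) = _
      refine Finset.prod_congr rfl fun j _ => (if_neg ?_).symm
      rintro ⟨rfl, h'⟩
      exact h' h
    · rw [if_neg h]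
      refine (Finset.prod_eq_zero (Finset.mem_univ i) ?_).symm
      exact if_pos ⟨rfl, h⟩
  have e' : ((jointChannel c).map fun ξ => ξ i) b =
      ∑ ξ : Fin N → Bool, ∏ j, if j = i ∧ b ≠ ξ j then 0 else (c j).channel (ξ j) := by
    rw [PMF.map_apply, tsum_fintype]
    refine Finset.sum_congr rfl fun ξ _ => ?_
    convert e ξ
  rw [e', ← Fintype.piFinset_univ,
    ← Finset.prod_univ_sum (fun _ => Finset.univ)
      fun j x => if j = i ∧ b ≠ x then 0 else (c j).channel x,
    Finset.prod_eq_single i]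
  · rw [Finset.sum_eq_single b]
    · simp
    · intro x _ hx
      exact if_pos ⟨rfl, hx.symm⟩
    · simp
  · intro j _ hj
    simp only [hj, false_and, if_false]
    rw [← tsum_fintype (L := .unconditional _)]
    exact (c j).channel.tsum_coe
  · simp

lemma expect_sum {α ι : Type} [Fintype ι] {p : PMF α} (hp : p.support.Finite)
    (f : ι → α → ℝ) : expect p (fun x => ∑ i, f i x) = ∑ i, expect p (f i) := by
  simp only [expect, Finset.mul_sum]
  exact Summable.tsum_finsetSum fun i _ => summable_expect hp (f i)

/-- For a separable function, linearity leaves only the marginal channels. -/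
lemma expect_scheduling_trans {K : ℕ} (s : Fin N → ℕ) (u : {u : Finset (Fin N) // u.card = K})
    (H : Fin N → ℕ → ℝ) :
    expect ((scheduling c K).trans s u) (fun s => ∑ i, H i (s i)) =
      ∑ i, expect (c i).channel fun b => H i (Client.nextState (s i) (decide (i ∈ u.1)) b) := by
  change expect ((jointChannel c).map _) _ = _
  rw [expect_map (Set.toFinite _), expect_sum (Set.toFinite _)]
  refine Finset.sum_congr rfl fun i _ => ?_
  rw [← map_eval_jointChannel, expect_map (Set.toFinite _)]

/-- The Lagrangian bound, for thresholds adapted to the subsidy `W`. -/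
lemma avgReward_scheduling_le {K : ℕ} (W : ℝ) (n : Fin N → ℕ)
    (h0 : ∀ i, ∀ m < n i, (c i).switchSubsidy m ≤ W) (h1 : ∀ i, W ≤ (c i).switchSubsidy (n i))
    (s₀ : Fin N → ℕ) (π : (scheduling c K).Policy) :
    (scheduling c K).avgReward π s₀ ≤
      ((∑ i, (c i).thresholdReward W (n i) - W * ((N : ℝ) - K) : ℝ) : EReal) := by
  have hinv : ∀ i, 0 < 1 / (c i).p := fun i => one_div_pos.2 (c i).p_pos
  -- The joint reward admits a single multiplier, so `κ` must dominate every `1 / p`; the summand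
  -- `1` keeps it positive when `N = 0`.
  set κ : ℝ := 1 + ∑ i, 1 / (c i).p with hκ
  have hκ0 : 0 < κ := by
    have := Finset.sum_nonneg fun i (_ : i ∈ Finset.univ) => (hinv i).le
    linarith
  have hκi : ∀ i, 1 / (c i).p ≤ κ := fun i => by
    have := Finset.single_le_sum (fun i _ => (hinv i).le) (Finset.mem_univ i)
    linarith
  choose C hC using fun i =>
    (c i).exists_neg_relValue_le_sub_slotReward W (n i) (hκi i)
  refine CtrlProcess.avgReward_le (C := ∑ i, C i) (fun s u => finite_support_map _ (Set.toFinite _))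
    π s₀ (fun s => ∑ i, (c i).relValue W (n i) (s i)) hκ0 (fun _ s u _ => ?_) fun s u => ?_
  · rw [expect_scheduling_trans c s u fun i => (c i).relValue W (n i)]
    -- Exactly `N - K` clients are passive, whatever the action: this is where the cardinality
    -- constraint enters.
    have hpass : ∑ i, (if decide (i ∈ u.1) = true then (0 : ℝ) else W) = W * ((N : ℝ) - K) := by
      have e : ∀ i, (if decide (i ∈ u.1) = true then (0 : ℝ) else W) =
          W - if i ∈ u.1 then W else 0 := fun i => by
        by_cases h : i ∈ u.1 <;> simp [h]
      simp only [e, Finset.sum_sub_distrib, Finset.sum_ite_mem, Finset.univ_inter,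
        Finset.sum_const, u.2, Finset.card_univ, Fintype.card_fin, nsmul_eq_mul]
      ring
    have hsum := Finset.sum_le_sum fun i (_ : i ∈ Finset.univ) =>
      (c i).relValue_optimality (h0 i) (h1 i) (s i) (decide (i ∈ u.1))
    -- The single-client transitions are rewritten over the channel, to match the marginal form of
    -- the joint transition.
    simp only [Client.expect_single_trans, ← Client.expect_nextState] at hsum
    simp only [Client.single, Finset.sum_add_distrib, hpass] at hsum
    change ∑ i, (c i).slotReward (s i) + _ ≤ _
    linarith
  · change _ ≤ _ - κ * ∑ i, (c i).slotReward (s i)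
    rw [Finset.mul_sum, ← Finset.sum_sub_distrib, ← Finset.sum_neg_distrib]
    exact Finset.sum_le_sum fun i _ => hC i (s i)

end Scheduling

lemma EReal.coe_finset_sum {ι : Type} (s : Finset ι) (f : ι → ℝ) :
    ((∑ i ∈ s, f i : ℝ) : EReal) = ∑ i ∈ s, (f i : EReal) := by
  classical
  induction s using Finset.induction_on with
  | empty => simp
  | insert a s ha ih => rw [Finset.sum_insert ha, Finset.sum_insert ha, EReal.coe_add, ih]

end

theorem mainTheorem4 (N K : ℕ) (hK : K ≤ N) (c : Fin N → Client) :
    -- every scheduling policy, from every initial state, is bounded by the Lagrangian bound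
    (∀ (s₀ : Fin N → ℕ) (π : (scheduling c K).Policy),
      (scheduling c K).avgReward π s₀ ≤
        ⨅ W ∈ Set.Ioi (0 : ℝ),
          ((∑ i, (c i).optAvg W) - ((W * ((N : ℝ) - K) : ℝ) : EReal))) ∧
    -- the Whittle indices, which determine the thresholds
    (∀ i (n : ℕ), (c i).whittleIndex n =
      ((n : ℝ) + 1) * (c i).R * (c i).p * (((n : ℝ) + 1) / 2 + (1 - (c i).p) / (c i).p + 1 / 2)
        + (c i).R * (c i).p * (c i).θ) ∧
    -- thresholds exist, and the corresponding threshold policies attain the maximal reward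
    (∀ i, ∀ W : ℝ, 0 < W → ∃ n, (c i).IsThresholdFor W n) ∧
    (∀ i, ∀ W : ℝ, 0 < W → ∀ n : ℕ, (c i).IsThresholdFor W n →
      (c i).ThresholdOptimal W n ∧
      (c i).optAvg W =
        ((W * (n * (c i).p / (n * (c i).p + 1))
          - (c i).R * (c i).p * ((n : ℝ) ^ 2 + n) / (2 * (n * (c i).p + 1))
          + (c i).R * (c i).p * (c i).θ / (n * (c i).p + 1)
          - (c i).R * (1 - (c i).p) / (c i).p : ℝ) : EReal)) ∧
    -- explicit forms of the bound, for every choice of thresholds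
    (∀ n : Fin N → ℝ → ℕ, (∀ i, ∀ W : ℝ, 0 < W → (c i).IsThresholdFor W (n i W)) →
      (⨅ W ∈ Set.Ioi (0 : ℝ),
          ((∑ i, (c i).optAvg W) - ((W * ((N : ℝ) - K) : ℝ) : EReal))) =
        (⨅ W ∈ Set.Ioi (0 : ℝ),
          ((((∑ i, (W * (n i W * (c i).p / (n i W * (c i).p + 1))
              - (c i).R * (c i).p * ((n i W : ℝ) ^ 2 + n i W) / (2 * (n i W * (c i).p + 1))
              + (c i).R * (c i).p * (c i).θ / (n i W * (c i).p + 1)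
              - (c i).R * (1 - (c i).p) / (c i).p))
            - W * ((N : ℝ) - K) : ℝ)) : EReal)) ∧
      (⨅ W ∈ Set.Ioi (0 : ℝ),
          ((∑ i, (c i).optAvg W) - ((W * ((N : ℝ) - K) : ℝ) : EReal))) =
        (⨅ W ∈ Set.Ioi (0 : ℝ),
          (((W * ((∑ i, n i W * (c i).p / (n i W * (c i).p + 1)) + K - N)
            + ∑ i, (- ((c i).R * (c i).p * ((n i W : ℝ) ^ 2 + n i W) / (2 * (n i W * (c i).p + 1)))
              + (c i).R * (c i).p * (c i).θ / (n i W * (c i).p + 1)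
              - (c i).R * (1 - (c i).p) / (c i).p) : ℝ)) : EReal))) := by
  have hbound : ∀ (n : Fin N → ℝ → ℕ),
      (∀ i, ∀ W : ℝ, 0 < W → (c i).IsThresholdFor W (n i W)) → ∀ W : ℝ, 0 < W →
      (∑ i, (c i).optAvg W) - ((W * ((N : ℝ) - K) : ℝ) : EReal) =
        ((∑ i, (c i).thresholdReward W (n i W) - W * ((N : ℝ) - K) : ℝ) : EReal) := by
    intro n hn W hW
    rw [EReal.coe_sub, EReal.coe_finset_sum]
    congr 1
    refine Finset.sum_congr rfl fun i _ => ?_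
    obtain ⟨h0, h1⟩ := ((c i).isThresholdFor_iff _ _).1 (hn i W hW)
    exact (c i).optAvg_eq h0 h1
  have hex : ∀ i, ∀ W : ℝ, 0 < W → ∃ n, (c i).IsThresholdFor W n := fun i W _ => by
    obtain ⟨n, h0, h1⟩ := (c i).exists_threshold W
    exact ⟨n, ((c i).isThresholdFor_iff _ _).2 ⟨h0, h1.le⟩⟩
  refine ⟨fun s₀ π => le_iInf₂ fun W hW => ?_, fun i n => (c i).whittleIndex_eq n, hex,
    fun i W _ n hn => ?_, fun n hn => ?_⟩
  -- For each fixed `W`, thresholds adapted to it make the Lagrangian expression a real number that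
  -- bounds the scheduler.
  · choose n hn using fun i => (c i).exists_threshold W
    rw [Finset.sum_congr rfl fun i _ => (c i).optAvg_eq (hn i).1 (hn i).2.le,
      ← EReal.coe_finset_sum, ← EReal.coe_sub]
    exact avgReward_scheduling_le c W n (fun i => (hn i).1) (fun i => (hn i).2.le) s₀ π
  · obtain ⟨h0, h1⟩ := ((c i).isThresholdFor_iff _ _).1 hn
    exact ⟨(c i).thresholdOptimal_of_switchSubsidy h0 h1, (c i).optAvg_eq h0 h1⟩
  · refine ⟨iInf_congr fun W => iInf_congr fun hW => hbound n hn W hW, iInf_congr fun W => iInf_congr fun hW => ?_⟩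
    rw [hbound n hn W hW, EReal.coe_eq_coe_iff]
    simp only [Client.thresholdReward, mul_add, mul_sub, Finset.mul_sum, Finset.sum_add_distrib,
      Finset.sum_sub_distrib, Finset.sum_neg_distrib]
    ring
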